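/- Theorem. Let $G$ be a locally compact topological group acting continuously on a non-empty compact metric space $(X,d)$, and assume that the action is minimal (every orbit is dense). Let $m\ge 2$ be an integer. Say that $(X,G)$ is $m$-sensitive if there is $\varepsilon>0$ such that for every non-empty open set $U\subseteq X$ there are distinct points $x_1,\dots,x_m\in U$ and an element $g\in G$ with $d(gx_i,gx_j)\ge\varepsilon$ for all $i\neq j$. Let $\pi_{eq}\colon X\to X_{eq}$ be the maximal equicontinuous factor of $(X,G)$, and let $$r_M(X,G)=\sup\{|\pi_{eq}^{-1}(y)| : y\in X_{eq}\}\in\mathbb{N}\cup\{\infty\}$$ be the maximal rank. Then $(X,G)$ is $m$-sensitive if and only if $r_M(X,G)\ge m$. -/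

import Mathlib

open Topology Set

universe u v w

/-- `φ : X → Y` is a factor map between actions of `G`: a continuous equivariant surjection. -/
structure IsFactorMap (G : Type v) {X : Type u} {Y : Type w} [TopologicalSpace X]
    [TopologicalSpace Y] [SMul G X] [SMul G Y] (φ : X → Y) : Prop where
  continuous : Continuous φ
  surjective : Function.Surjective φ
  map_smul : ∀ (g : G) (x : X), φ (g • x) = g • φ x

/-- The action of `G` on the metric space `X` is equicontinuous. -/
def IsEquicontinuousAction (G : Type v) (X : Type u) [MetricSpace X] [SMul G X] : Prop :=
  ∀ ε > 0, ∃ δ > 0, ∀ x y : X, dist x y < δ → ∀ g : G, dist (g • x) (g • y) < ε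

/-- The action of `G` on `X` is `m`-sensitive: for some `ε > 0`, every non-empty open set contains
`m` distinct points which some `g` in `G` makes pairwise at least `ε` apart. -/
def IsMultiSensitive (G : Type v) (X : Type u) [MetricSpace X] [SMul G X] (m : ℕ) : Prop :=
  ∃ ε > 0, ∀ U : Set X, IsOpen U → U.Nonempty →
    ∃ x : Fin m → X, Function.Injective x ∧ (∀ i, x i ∈ U) ∧
      ∃ g : G, ∀ i j, i ≠ j → ε ≤ dist (g • x i) (g • x j)

/-- Two points of `X` are related when every equicontinuous factor of `X` identifies them.
Factors in other universes give nothing new: see `MaxEqFactor.universal`. -/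
def maxEqSetoid (G : Type v) (X : Type u) [Group G] [TopologicalSpace G] [MetricSpace X]
    [MulAction G X] : Setoid X where
  r x y := ∀ (Y : Type u) [MetricSpace Y] [CompactSpace Y] [MulAction G Y] [ContinuousSMul G Y]
    (φ : X → Y), IsFactorMap G φ → IsEquicontinuousAction G Y → φ x = φ y
  iseqv :=
    { refl := fun _ _ _ _ _ _ _ _ _ => rfl
      symm := fun h Y _ _ _ _ φ hφ hY => (h Y φ hφ hY).symm
      trans := fun h h' Y _ _ _ _ φ hφ hY => (h Y φ hφ hY).trans (h' Y φ hφ hY) }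

/-- The maximal equicontinuous factor `X_eq`, as a quotient space of `X`. That it is an
equicontinuous factor of `X`, and the largest one, is proved below
(`MaxEqFactor.isFactorMap`, `MaxEqFactor.isEquicontinuousAction`, `MaxEqFactor.universal`). -/
def MaxEqFactor (G : Type v) (X : Type u) [Group G] [TopologicalSpace G] [MetricSpace X]
    [MulAction G X] : Type u :=
  Quotient (maxEqSetoid G X)

namespace MaxEqFactor

variable (G : Type v) (X : Type u) [Group G] [TopologicalSpace G] [MetricSpace X]
  [MulAction G X]

/-- The factor map `π_eq : X → X_eq`. -/
def proj (x : X) : MaxEqFactor G X := Quotient.mk (maxEqSetoid G X) x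

instance : TopologicalSpace (MaxEqFactor G X) :=
  inferInstanceAs (TopologicalSpace (Quotient (maxEqSetoid G X)))

theorem proj_surjective : Function.Surjective (proj G X) := Quotient.mk_surjective

theorem continuous_proj : Continuous (proj G X) := continuous_quot_mk

theorem isQuotientMap_proj : IsQuotientMap (proj G X) := isQuotientMap_quot_mk

instance [CompactSpace X] : CompactSpace (MaxEqFactor G X) :=
  inferInstanceAs (CompactSpace (Quotient (maxEqSetoid G X)))

/-- The induced action, `g • π_eq x = π_eq (g • x)`. -/
instance : MulAction G (MaxEqFactor G X) where
  smul g := Quotient.map (fun x => g • x) (by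
    intro x y h Y _ _ _ _ φ hφ hY
    simp only [hφ.map_smul]
    rw [h Y φ hφ hY])
  one_smul z := by
    obtain ⟨x, rfl⟩ := proj_surjective G X z
    exact congrArg (proj G X) (one_smul G x)
  mul_smul g h z := by
    obtain ⟨x, rfl⟩ := proj_surjective G X z
    exact congrArg (proj G X) (mul_smul g h x)

theorem proj_smul (g : G) (x : X) : proj G X (g • x) = g • proj G X x := rfl

theorem isFactorMap : IsFactorMap G (proj G X) :=
  ⟨continuous_proj G X, proj_surjective G X, proj_smul G X⟩

/-- The map `X_eq → Y` induced by an equicontinuous factor map `X → Y`. -/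
def lift {G : Type v} {X : Type u} [Group G] [TopologicalSpace G] [MetricSpace X]
    [MulAction G X] {Y : Type u} [MetricSpace Y] [CompactSpace Y] [MulAction G Y]
    [ContinuousSMul G Y] {φ : X → Y} (hφ : IsFactorMap G φ) (hY : IsEquicontinuousAction G Y) :
    MaxEqFactor G X → Y :=
  Quotient.lift φ (fun _ _ h => h Y φ hφ hY)

section lift

variable {G X}
variable {Y : Type u} [MetricSpace Y] [CompactSpace Y] [MulAction G Y]
  [ContinuousSMul G Y] {φ : X → Y} (hφ : IsFactorMap G φ) (hY : IsEquicontinuousAction G Y)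

theorem lift_proj (x : X) : lift hφ hY (proj G X x) = φ x := rfl

theorem isFactorMap_lift : IsFactorMap G (lift hφ hY) where
  continuous := (isQuotientMap_proj G X).continuous_iff.2 hφ.continuous
  surjective y := by
    obtain ⟨x, rfl⟩ := hφ.surjective y
    exact ⟨proj G X x, rfl⟩
  map_smul g z := by
    obtain ⟨x, rfl⟩ := proj_surjective G X z
    exact hφ.map_smul g x

end lift

instance : T2Space (MaxEqFactor G X) := by
  refine ⟨fun z w hzw => ?_⟩
  obtain ⟨x, rfl⟩ := proj_surjective G X z
  obtain ⟨y, rfl⟩ := proj_surjective G X w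
  have h : ¬ (maxEqSetoid G X).r x y := fun h => hzw (Quotient.sound h)
  change ¬ ∀ (Y : Type u) [MetricSpace Y] [CompactSpace Y] [MulAction G Y] [ContinuousSMul G Y]
    (φ : X → Y), IsFactorMap G φ → IsEquicontinuousAction G Y → φ x = φ y at h
  push Not at h
  obtain ⟨Y, _, _, _, _, φ, hφ, hY, hne⟩ := h
  exact separated_by_continuous (isFactorMap_lift hφ hY).continuous hne

section compact

variable [CompactSpace X]

instance : SecondCountableTopology (MaxEqFactor G X) := by
  set p := proj G X with hp
  have hc : IsClosedMap p := (continuous_proj G X).isClosedMap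
  set b := TopologicalSpace.countableBasis X
  have hb := TopologicalSpace.isBasis_countableBasis X
  set B : Set (Set (MaxEqFactor G X)) :=
    (fun F : Set (Set X) => (p '' (⋃₀ F)ᶜ)ᶜ) '' {F | F.Finite ∧ F ⊆ b} with hB
  have hBo : ∀ s ∈ B, IsOpen s := by
    rintro _ ⟨F, ⟨-, hF⟩, rfl⟩
    have : IsOpen (⋃₀ F) := isOpen_sUnion fun s hs => hb.isOpen (hF hs)
    exact (hc _ this.isClosed_compl).isOpen_compl
  refine (TopologicalSpace.isTopologicalBasis_of_isOpen_of_nhds hBo ?_).secondCountableTopology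
    ((Set.countable_ofPred_finite_subset
      (TopologicalSpace.countable_countableBasis X)).image _)
  intro z V hz hV
  have hK : IsCompact (p ⁻¹' {z}) := (isClosed_singleton.preimage (continuous_proj G X)).isCompact
  have hV' : IsOpen (p ⁻¹' V) := hV.preimage (continuous_proj G X)
  have hsub : p ⁻¹' {z} ⊆ ⋃₀ {s ∈ b | s ⊆ p ⁻¹' V} := by
    intro x hx
    have hxV : x ∈ p ⁻¹' V := by
      have : p x = z := hx
      simpa [this] using hz
    obtain ⟨s, hs, hxs, hsV⟩ := hb.exists_subset_of_mem_open hxV hV'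
    exact ⟨s, ⟨hs, hsV⟩, hxs⟩
  rw [sUnion_eq_biUnion] at hsub
  obtain ⟨F, hFs, hFf, hF⟩ := hK.elim_finite_subcover_image
    (fun s hs => hb.isOpen hs.1) hsub
  rw [← sUnion_eq_biUnion] at hF
  refine ⟨_, ⟨F, ⟨hFf, fun s hs => (hFs hs).1⟩, rfl⟩, ?_, ?_⟩
  · rintro ⟨x, hx, hxz⟩
    exact hx (hF hxz)
  · intro w hw
    obtain ⟨x, rfl⟩ := proj_surjective G X w
    by_contra hxV
    refine hw ⟨x, ?_, rfl⟩
    rintro ⟨s, hs, hxs⟩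
    exact hxV ((hFs hs).2 hxs)

/-- A metric on `X_eq` that induces its quotient topology. -/
noncomputable instance : MetricSpace (MaxEqFactor G X) :=
  letI : TopologicalSpace.MetrizableSpace (MaxEqFactor G X) :=
    TopologicalSpace.metrizableSpace_of_t3_secondCountable _
  TopologicalSpace.metrizableSpaceMetric (MaxEqFactor G X)

instance [ContinuousSMul G X] : ContinuousSMul G (MaxEqFactor G X) := by
  refine ⟨?_⟩
  have hp : IsProperMap (proj G X) := (continuous_proj G X).isProperMap
  have hq : IsQuotientMap (Prod.map (id : G → G) (proj G X)) :=
    ((Homeomorph.refl G).isProperMap.prodMap hp).isClosedMap.isQuotientMap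
      (continuous_id.prodMap (continuous_proj G X))
      (Function.surjective_id.prodMap (proj_surjective G X))
  exact hq.continuous_iff.2 ((continuous_proj G X).comp continuous_smul)

/-- The maximal equicontinuous factor is equicontinuous. -/
theorem isEquicontinuousAction : IsEquicontinuousAction G (MaxEqFactor G X) := by
  intro ε hε
  set K : Set (MaxEqFactor G X × MaxEqFactor G X) := {p | ε ≤ dist p.1 p.2} with hKdef
  have hK : IsCompact K := (isClosed_le continuous_const continuous_dist).isCompact
  suffices h : ∃ δ > 0, ∀ z w : MaxEqFactor G X, dist z w < δ → ∀ g : G, (g • z, g • w) ∉ K by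
    obtain ⟨δ, hδ, h⟩ := h
    exact ⟨δ, hδ, fun z w hzw g => not_le.1 (h z w hzw g)⟩
  refine hK.induction_on (p := fun S => ∃ δ > 0, ∀ z w : MaxEqFactor G X, dist z w < δ →
    ∀ g : G, (g • z, g • w) ∉ S) ⟨1, one_pos, fun _ _ _ _ => notMem_empty _⟩ ?_ ?_ ?_
  · rintro S T hST ⟨δ, hδ, h⟩
    exact ⟨δ, hδ, fun z w hzw g hS => h z w hzw g (hST hS)⟩
  · rintro S T ⟨δ, hδ, h⟩ ⟨δ', hδ', h'⟩
    refine ⟨min δ δ', lt_min hδ hδ', fun z w hzw g hST => ?_⟩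
    rcases hST with hS | hT
    · exact h z w (hzw.trans_le (min_le_left _ _)) g hS
    · exact h' z w (hzw.trans_le (min_le_right _ _)) g hT
  · rintro ⟨z₀, w₀⟩ hp
    have hne : z₀ ≠ w₀ := by
      rintro rfl
      have : ε ≤ dist z₀ z₀ := hp
      rw [dist_self] at this
      exact absurd hε (not_lt.2 this)
    obtain ⟨x, rfl⟩ := proj_surjective G X z₀
    obtain ⟨y, rfl⟩ := proj_surjective G X w₀
    have h : ¬ (maxEqSetoid G X).r x y := fun h => hne (Quotient.sound h)
    change ¬ ∀ (Y : Type u) [MetricSpace Y] [CompactSpace Y] [MulAction G Y] [ContinuousSMul G Y]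
      (φ : X → Y), IsFactorMap G φ → IsEquicontinuousAction G Y → φ x = φ y at h
    push Not at h
    obtain ⟨Y, _, _, _, _, φ, hφ, hY, hxy⟩ := h
    have hf := isFactorMap_lift hφ hY
    set f := lift hφ hY with hfdef
    have hpos : 0 < dist (f (proj G X x)) (f (proj G X y)) := dist_pos.2 hxy
    obtain ⟨r, hr, hr'⟩ := exists_between hpos
    obtain ⟨η, hη, hηY⟩ := hY r hr
    obtain ⟨δ, hδ, hδf⟩ := Metric.uniformContinuous_iff.1
      (CompactSpace.uniformContinuous_of_continuous hf.continuous) η hη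
    refine ⟨{p | r < dist (f p.1) (f p.2)}, mem_nhdsWithin_of_mem_nhds ?_, δ, hδ, ?_⟩
    · exact (isOpen_lt continuous_const ((hf.continuous.comp continuous_fst).dist
        (hf.continuous.comp continuous_snd))).mem_nhds hr'
    · intro z w hzw g hlt
      have h1 := hηY (f z) (f w) (hδf hzw) g
      rw [← hf.map_smul, ← hf.map_smul] at h1
      exact lt_asymm h1 hlt

end compact

/-- Every equicontinuous factor of `X` is a factor of `X_eq`, compatibly with the projections. -/
theorem universal {Y : Type w} [MetricSpace Y] [CompactSpace Y] [MulAction G Y]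
    [ContinuousSMul G Y] {φ : X → Y} (hφ : IsFactorMap G φ) (hY : IsEquicontinuousAction G Y) :
    ∃ ψ : MaxEqFactor G X → Y, IsFactorMap G ψ ∧ ψ ∘ proj G X = φ := by
  -- transport the structure of `Y` to a copy of `Y` in the universe of `X`
  have : Small.{u} Y := small_of_surjective hφ.surjective
  let e : Y ≃ Shrink.{u} Y := equivShrink Y
  let : MetricSpace (Shrink.{u} Y) := MetricSpace.induced e.symm e.symm.injective inferInstance
  let : MulAction G (Shrink.{u} Y) := e.symm.mulAction G
  have he' : Isometry e.symm := fun _ _ => rfl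
  have he : Isometry e := he'.right_inv e.symm_apply_apply
  have hes : ∀ (g : G) (y : Shrink.{u} Y), e.symm (g • y) = g • e.symm y := fun g y =>
    e.symm_apply_apply _
  have hes' : ∀ (g : G) (y : Y), e (g • y) = g • e y := fun g y => by
    apply e.symm.injective
    rw [hes, e.symm_apply_apply, e.symm_apply_apply]
  have : CompactSpace (Shrink.{u} Y) := e.surjective.compactSpace he.continuous
  have : ContinuousSMul G (Shrink.{u} Y) := by
    refine ⟨he'.isEmbedding.continuous_iff.2 ?_⟩
    have : (e.symm ∘ fun p : G × Shrink.{u} Y => p.1 • p.2) = fun p => p.1 • e.symm p.2 :=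
      funext fun p => hes p.1 p.2
    rw [this]
    exact continuous_fst.smul (he'.continuous.comp continuous_snd)
  have hφ' : IsFactorMap G (e ∘ φ) :=
    ⟨he.continuous.comp hφ.continuous, e.surjective.comp hφ.surjective, fun g x => by
      simp only [Function.comp_apply, hφ.map_smul, hes']⟩
  have hY' : IsEquicontinuousAction G (Shrink.{u} Y) := by
    intro ε hε
    obtain ⟨δ, hδ, h⟩ := hY ε hε
    refine ⟨δ, hδ, fun x y hxy g => ?_⟩
    rw [← he'.dist_eq, hes, hes]
    exact h _ _ (by rwa [he'.dist_eq]) g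
  have hl := isFactorMap_lift hφ' hY'
  refine ⟨e.symm ∘ lift hφ' hY', ⟨he'.continuous.comp hl.continuous,
    e.symm.surjective.comp hl.surjective, fun g z => ?_⟩, funext fun x => ?_⟩
  · simp only [Function.comp_apply, hl.map_smul, hes]
  · exact e.symm_apply_apply (φ x)

end MaxEqFactor

/-- The maximal rank `r_M(X, G)`: the supremum of the cardinalities of the fibers of `π_eq`, in
`ℕ ∪ {∞}`. -/
noncomputable def maximalRank (G : Type v) (X : Type u) [Group G] [TopologicalSpace G]
    [MetricSpace X] [MulAction G X] : ℕ∞ :=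
  ⨆ z : MaxEqFactor G X, (MaxEqFactor.proj G X ⁻¹' {z}).encard

/-! If the action is `m`-sensitive, take separated tuples in balls shrinking to one point. Limits of
their translates are `m` distinct points, and equicontinuity of `X_eq` puts them in one fiber.

For the converse, failure of sensitivity first yields an invariant measure, although `G` is not
assumed amenable. For each `ε` there is a non-empty open `U` all of whose translates lie within `ε`
of at most `m` points, and finitely many translates cover `X`. Hence fractional covering numbers by
such sets, summed over a decomposition of `f`, are at most about `m * sup f` times the covering
number of `1` (`exists_sum_fractionalCover_le`). Normalizing and letting `ε → 0` gives an invariant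
sublinear functional. Its supremum over decompositions is finite and additive, so the Riesz theorem
gives an invariant measure (`exists_invariant_measure`), of full support by minimality.

Given a finite invariant measure on `Z`, all slices of a closed invariant `R ⊆ X × Z` have the same
measure. The measure of the difference of two slices is then a continuous invariant pseudometric on
`X`, so points of one fiber of `π_eq` have slices equal up to null sets. Apply this to the orbit
closure `N` of `U^m`: coordinates can be exchanged within fibers, one at a time
(`update_mem_of_proj_eq`), until `N` contains every `m`-tuple lying over an open `W ⊆ π_eq(U)`, and
then, by minimality, every `m`-tuple inside a single fiber. So `m` distinct points of a fiber are
approximated by translates of points of `U`, for every `U`: this is sensitivity. -/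

open MeasureTheory Filter
open scoped NNReal ENNReal Pointwise CompactlySupported

/-! ### Invariant pseudometrics and the maximal equicontinuous factor -/

section Pseudometric

/-- A continuous pseudometric on `X` that is invariant under the action of `G`. -/
structure InvariantPseudometric (G : Type v) (X : Type u) [TopologicalSpace X] [SMul G X] where
  /-- the distance function -/
  toFun : X → X → ℝ
  self : ∀ x, toFun x x = 0
  comm : ∀ x y, toFun x y = toFun y x
  triangle : ∀ x y z, toFun x z ≤ toFun x y + toFun y z
  tendsto : ∀ x, Tendsto (fun y => toFun y x) (𝓝 x) (𝓝 0)
  smul : ∀ (g : G) x y, toFun (g • x) (g • y) = toFun x y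

namespace InvariantPseudometric

variable {G : Type v} {X : Type u} [Group G] [MetricSpace X] [MulAction G X]

/-- A copy of `X` that carries the pseudometric `D`. -/
def Copy (_D : InvariantPseudometric G X) : Type u := X

variable (D : InvariantPseudometric G X)

instance : PseudoMetricSpace D.Copy where
  dist := D.toFun
  dist_self := D.self
  dist_comm := D.comm
  dist_triangle := D.triangle

instance : MulAction G D.Copy := inferInstanceAs (MulAction G X)

/-- The identity map from `X` to its copy. -/
def toCopy (x : X) : D.Copy := x

theorem continuous_toCopy : Continuous D.toCopy :=
  continuous_iff_continuousAt.2 fun x => tendsto_iff_dist_tendsto_zero.2 (D.tendsto x)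

instance [CompactSpace X] : CompactSpace D.Copy :=
  (show Function.Surjective D.toCopy from fun x => ⟨x, rfl⟩).compactSpace D.continuous_toCopy

theorem dist_smul_copy (g : G) (x y : D.Copy) : dist (g • x) (g • y) = dist x y := D.smul g x y

instance [TopologicalSpace G] [ContinuousSMul G X] : ContinuousSMul G D.Copy := by
  refine ⟨continuous_iff_continuousAt.2 fun ⟨g, x⟩ => tendsto_iff_dist_tendsto_zero.2 ?_⟩
  have h1 : Tendsto (fun p : G × D.Copy => dist p.2 x) (𝓝 (g, x)) (𝓝 0) := by
    have : Continuous fun p : G × D.Copy => dist p.2 x := by fun_prop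
    simpa using this.tendsto (g, x)
  have h2 : Tendsto (fun p : G × D.Copy => dist (p.1 • x) (g • x)) (𝓝 (g, x)) (𝓝 0) := by
    have hc : Continuous fun h : G => h • x :=
      D.continuous_toCopy.comp (continuous_id.smul continuous_const : Continuous
        fun h : G => h • (show X from x))
    have : Continuous fun p : G × D.Copy => dist (p.1 • x) (g • x) :=
      (hc.comp continuous_fst).dist continuous_const
    simpa using this.tendsto (g, x)
  refine squeeze_zero (fun _ => dist_nonneg) (fun p => ?_) (by simpa using h1.add h2)
  calc dist (p.1 • p.2) (g • x) ≤ dist (p.1 • p.2) (p.1 • x) + dist (p.1 • x) (g • x) :=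
        dist_triangle _ _ _
    _ = _ := by rw [dist_smul_copy]

/-- Points with the same image in the maximal equicontinuous factor are not distinguished by an
invariant continuous pseudometric. -/
theorem eq_zero_of_proj_eq [TopologicalSpace G] [CompactSpace X] [ContinuousSMul G X] {x y : X}
    (h : MaxEqFactor.proj G X x = MaxEqFactor.proj G X y) : D.toFun x y = 0 := by
  have hr : (maxEqSetoid G X).r x y := Quotient.exact h
  -- Collapsing the pairs at distance zero gives a factor on which `G` acts by isometries, hence an
  -- equicontinuous one.
  have hφ : IsFactorMap G (fun x => SeparationQuotient.mk (D.toCopy x)) :=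
    ⟨SeparationQuotient.continuous_mk.comp D.continuous_toCopy,
      fun z => by
        obtain ⟨x, rfl⟩ := SeparationQuotient.surjective_mk z
        exact ⟨x, rfl⟩,
      fun g x => rfl⟩
  have hY : IsEquicontinuousAction G (SeparationQuotient D.Copy) := by
    intro ε hε
    refine ⟨ε, hε, fun z w hzw g => ?_⟩
    obtain ⟨x, rfl⟩ := SeparationQuotient.surjective_mk z
    obtain ⟨y, rfl⟩ := SeparationQuotient.surjective_mk w
    rw [← SeparationQuotient.mk_smul, ← SeparationQuotient.mk_smul, SeparationQuotient.dist_mk,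
      dist_smul_copy]
    rwa [SeparationQuotient.dist_mk] at hzw
  have : CompactSpace (SeparationQuotient D.Copy) :=
    SeparationQuotient.surjective_mk.compactSpace SeparationQuotient.continuous_mk
  have := hr (SeparationQuotient D.Copy) _ hφ hY
  rw [← dist_eq_zero, SeparationQuotient.dist_mk] at this
  exact this

end InvariantPseudometric

end Pseudometric

/-! ### Slices of closed invariant relations -/

section Slices

/-- Projection along the compact factor `Z` is a closed map, so slices vary upper semicontinuously.
-/
theorem eventually_slice_subset {X : Type u} {Z : Type w} [TopologicalSpace X]
    [TopologicalSpace Z] [CompactSpace Z] {R : Set (X × Z)} (hR : IsClosed R) {x : X} {O : Set Z}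
    (hO : IsOpen O) (hxO : Prod.mk x ⁻¹' R ⊆ O) : ∀ᶠ y in 𝓝 x, Prod.mk y ⁻¹' R ⊆ O := by
  have hc : IsClosed (Prod.fst '' (R ∩ Prod.snd ⁻¹' Oᶜ)) :=
    isClosedMap_fst_of_compactSpace _ (hR.inter (hO.isClosed_compl.preimage continuous_snd))
  have hx : x ∈ (Prod.fst '' (R ∩ Prod.snd ⁻¹' Oᶜ))ᶜ := by
    rintro ⟨⟨_, w⟩, ⟨h1, h2⟩, rfl⟩
    exact h2 (hxO h1)
  filter_upwards [hc.isOpen_compl.mem_nhds hx] with y hy w hw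
  by_contra hwO
  exact hy ⟨(y, w), ⟨hw, hwO⟩, rfl⟩

theorem slice_smul {G : Type v} {X : Type u} {Z : Type w} [Group G] [MulAction G X]
    [MulAction G Z] {R : Set (X × Z)} (hGR : ∀ (g : G) x z, (x, z) ∈ R → (g • x, g • z) ∈ R)
    (g : G) (x : X) :
    Prod.mk (g • x) ⁻¹' R = (fun z => g⁻¹ • z) ⁻¹' (Prod.mk x ⁻¹' R) := by
  ext z
  refine ⟨fun h => ?_, fun h => ?_⟩
  · simpa using hGR g⁻¹ _ _ h
  · simpa using hGR g _ _ h

variable {G : Type v} {X : Type u} [Group G] [MetricSpace X]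
  [MulAction G X] [MulAction.IsMinimal G X]
  {Z : Type w} [TopologicalSpace Z] [CompactSpace Z] [MulAction G Z]
  [MeasurableSpace Z] (ν : Measure Z) [ν.OuterRegular]
  [SMulInvariantMeasure G Z ν] {R : Set (X × Z)}

/-- By outer regularity the measure of a slice is upper semicontinuous in the base point, so its
superlevel sets are closed and invariant; minimality leaves only `∅` and `univ`. -/
theorem measure_slice_const [IsFiniteMeasure ν] (hR : IsClosed R)
    (hGR : ∀ (g : G) x z, (x, z) ∈ R → (g • x, g • z) ∈ R) (x y : X) :
    ν (Prod.mk x ⁻¹' R) = ν (Prod.mk y ⁻¹' R) := by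
  suffices h : ∀ x y, ν (Prod.mk x ⁻¹' R) ≤ ν (Prod.mk y ⁻¹' R) from le_antisymm (h x y) (h y x)
  clear x y
  intro x y
  have hc : IsClosed {y | ν (Prod.mk x ⁻¹' R) ≤ ν (Prod.mk y ⁻¹' R)} := by
    rw [← isOpen_compl_iff, isOpen_iff_mem_nhds]
    intro z hz
    obtain ⟨O, hzO, hO, hνO⟩ := Set.exists_isOpen_lt_of_lt (μ := ν) _ _ (not_le.1 hz)
    filter_upwards [eventually_slice_subset hR hO hzO] with y hy
    exact not_le.2 ((measure_mono hy).trans_lt hνO)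
  have hinv : ∀ g : G, g • {y | ν (Prod.mk x ⁻¹' R) ≤ ν (Prod.mk y ⁻¹' R)} ⊆
      {y | ν (Prod.mk x ⁻¹' R) ≤ ν (Prod.mk y ⁻¹' R)} := by
    rintro g _ ⟨y, hy, rfl⟩
    change _ ≤ ν (Prod.mk (g • y) ⁻¹' R)
    rw [slice_smul hGR, measure_preimage_smul]
    exact hy
  rcases eq_empty_or_univ_of_smul_invariant_closed G hc hinv with h | h
  · exact absurd (show x ∈ _ from le_refl (ν (Prod.mk x ⁻¹' R))) (h ▸ notMem_empty x)
  · exact (h.symm ▸ mem_univ y : y ∈ {y | ν (Prod.mk x ⁻¹' R) ≤ ν (Prod.mk y ⁻¹' R)})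

variable [BorelSpace Z]

theorem measureReal_slice_diff_comm [IsFiniteMeasure ν] (hR : IsClosed R)
    (hGR : ∀ (g : G) x z, (x, z) ∈ R → (g • x, g • z) ∈ R) (x y : X) :
    ν.real (Prod.mk x ⁻¹' R \ Prod.mk y ⁻¹' R) = ν.real (Prod.mk y ⁻¹' R \ Prod.mk x ⁻¹' R) := by
  have hm : ∀ x, MeasurableSet (Prod.mk x ⁻¹' R) := fun x =>
    (hR.preimage (by fun_prop)).measurableSet
  have h1 := measureReal_sdiff_add_inter (μ := ν) (s := Prod.mk x ⁻¹' R) (hm y)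
  have h2 := measureReal_sdiff_add_inter (μ := ν) (s := Prod.mk y ⁻¹' R) (hm x)
  have h3 : ν.real (Prod.mk x ⁻¹' R) = ν.real (Prod.mk y ⁻¹' R) :=
    congrArg ENNReal.toReal (measure_slice_const ν hR hGR x y)
  rw [inter_comm] at h2
  linarith

/-- The measure of the difference of two slices of a closed invariant relation. -/
noncomputable def sliceDist [IsFiniteMeasure ν] (hR : IsClosed R)
    (hGR : ∀ (g : G) x z, (x, z) ∈ R → (g • x, g • z) ∈ R) : InvariantPseudometric G X where
  toFun x y := ν.real (Prod.mk x ⁻¹' R \ Prod.mk y ⁻¹' R)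
  self x := by simp
  comm := measureReal_slice_diff_comm ν hR hGR
  triangle x y z := (measureReal_mono (fun w hw => by
    by_cases h : w ∈ Prod.mk y ⁻¹' R
    · exact Or.inr ⟨h, hw.2⟩
    · exact Or.inl ⟨hw.1, h⟩)).trans (measureReal_union_le _ _)
  -- Only the part of the nearby slice outside the slice at `x` has to be small, so upper
  -- semicontinuity suffices.
  tendsto x := by
    have hm : MeasurableSet (Prod.mk x ⁻¹' R) := (hR.preimage (by fun_prop)).measurableSet
    refine tendsto_order.2 ⟨fun a ha => Eventually.of_forall fun y =>
      ha.trans_le measureReal_nonneg, fun a ha => ?_⟩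
    obtain ⟨O, hxO, hO, -, hνO⟩ := hm.exists_isOpen_sdiff_lt (measure_ne_top ν _)
      (ENNReal.ofReal_pos.2 ha).ne'
    filter_upwards [eventually_slice_subset hR hO hxO] with y hy
    refine (ENNReal.toReal_lt_of_lt_ofReal ?_)
    exact (measure_mono (sdiff_subset_sdiff_left hy)).trans_lt hνO
  smul g x y := by
    rw [slice_smul hGR, slice_smul hGR, ← preimage_sdiff, measureReal_def, measure_preimage_smul,
      measureReal_def]

theorem measure_slice_diff_eq_zero [IsFiniteMeasure ν] [TopologicalSpace G] [CompactSpace X]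
    [ContinuousSMul G X] (hR : IsClosed R)
    (hGR : ∀ (g : G) x z, (x, z) ∈ R → (g • x, g • z) ∈ R) {x y : X}
    (h : MaxEqFactor.proj G X x = MaxEqFactor.proj G X y) :
    ν (Prod.mk x ⁻¹' R \ Prod.mk y ⁻¹' R) = 0 :=
  (measureReal_eq_zero_iff).1 ((sliceDist ν hR hGR).eq_zero_of_proj_eq h)

end Slices

/-! ### Fractional covering numbers -/

section FractionalCover

variable {G : Type v} {X : Type u}

/-- The weighted sum of the indicators of the sets in a list. -/
noncomputable def coverSum (L : List (ℝ≥0 × Set X)) (x : X) : ℝ≥0 :=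
  (L.map fun q => q.1 * q.2.indicator 1 x).sum

/-- The list `L` of weighted members of `𝒰` covers the function `f`. -/
def IsFractionalCover (𝒰 : Set (Set X)) (f : X → ℝ≥0) (L : List (ℝ≥0 × Set X)) : Prop :=
  (∀ q ∈ L, q.2 ∈ 𝒰) ∧ ∀ x, f x ≤ coverSum L x

/-- The total weight of a weighted list of sets. -/
def coverCost (L : List (ℝ≥0 × Set X)) : ℝ≥0 := (L.map Prod.fst).sum

/-- The fractional covering number of the function `f` by members of `𝒰`. -/
noncomputable def fractionalCover (𝒰 : Set (Set X)) (f : X → ℝ≥0) : ℝ≥0∞ :=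
  ⨅ (L) (_ : IsFractionalCover 𝒰 f L), (coverCost L : ℝ≥0∞)

variable {𝒰 : Set (Set X)} {f g : X → ℝ≥0} {L L' : List (ℝ≥0 × Set X)}

theorem IsFractionalCover.le_cost (h : IsFractionalCover 𝒰 f L) :
    fractionalCover 𝒰 f ≤ coverCost L := iInf₂_le L h

theorem IsFractionalCover.append (h : IsFractionalCover 𝒰 f L) (h' : IsFractionalCover 𝒰 g L') :
    IsFractionalCover 𝒰 (f + g) (L ++ L') := by
  refine ⟨fun q hq => ?_, fun x => ?_⟩
  · rcases List.mem_append.1 hq with hq | hq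
    exacts [h.1 q hq, h'.1 q hq]
  · simpa [coverSum] using add_le_add (h.2 x) (h'.2 x)

theorem fractionalCover_add_le :
    fractionalCover 𝒰 (f + g) ≤ fractionalCover 𝒰 f + fractionalCover 𝒰 g := by
  conv_rhs => rw [fractionalCover, fractionalCover]
  simp only [ENNReal.iInf_add, ENNReal.add_iInf]
  refine le_iInf fun L' => le_iInf fun hL' => le_iInf fun L => le_iInf fun hL => ?_
  refine (hL.append hL').le_cost.trans (le_of_eq ?_)
  simp [coverCost]

theorem fractionalCover_smul_le {c : ℝ≥0} (hc : c ≠ 0) :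
    fractionalCover 𝒰 (c • f) ≤ c * fractionalCover 𝒰 f := by
  conv_rhs => rw [fractionalCover]
  simp only [ENNReal.mul_iInf_of_ne (ENNReal.coe_ne_zero.2 hc) ENNReal.coe_ne_top]
  refine le_iInf₂ fun L hL => ?_
  have : IsFractionalCover 𝒰 (c • f) (L.map fun q => (c * q.1, q.2)) := by
    refine ⟨fun q hq => ?_, fun x => ?_⟩
    · obtain ⟨q, hq', rfl⟩ := List.mem_map.1 hq
      exact hL.1 q hq'
    · have := mul_le_mul_right (hL.2 x) c
      simpa [coverSum, Function.comp_def, mul_assoc, List.sum_map_mul_left] using this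
  refine this.le_cost.trans (le_of_eq ?_)
  simp [coverCost, Function.comp_def, List.sum_map_mul_left]

theorem fractionalCover_comp_smul_le [Group G] [MulAction G X] (g : G)
    (h𝒰 : ∀ (g : G), ∀ U ∈ 𝒰, (fun x => g • x) ⁻¹' U ∈ 𝒰) :
    fractionalCover 𝒰 (fun x => f (g • x)) ≤ fractionalCover 𝒰 f := by
  refine le_iInf₂ fun L hL => ?_
  have : IsFractionalCover 𝒰 (fun x => f (g • x))
      (L.map fun q => (q.1, (fun x => g • x) ⁻¹' q.2)) := by
    refine ⟨fun q hq => ?_, fun x => (hL.2 (g • x)).trans (le_of_eq ?_)⟩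
    · obtain ⟨q, hq', rfl⟩ := List.mem_map.1 hq
      exact h𝒰 g _ (hL.1 q hq')
    · simp only [coverSum, List.map_map]
      rfl
  refine this.le_cost.trans (le_of_eq ?_)
  simp [coverCost, Function.comp_def]

/-- For `f = 1` this bounds the normalizing denominator away from `0`. -/
theorem le_fractionalCover (x : X) : (f x : ℝ≥0∞) ≤ fractionalCover 𝒰 f := by
  refine le_iInf₂ fun L hL => ENNReal.coe_le_coe.2 ((hL.2 x).trans ?_)
  refine List.sum_le_sum fun q _ => ?_
  by_cases h : x ∈ q.2 <;> simp [h]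

/-- Functions whose values on each member of `𝒰` have bounds with controlled sum are covered at
controlled total cost. -/
theorem sum_fractionalCover_le {F : List (X → ℝ≥0)} {b : (X → ℝ≥0) → Set X → ℝ≥0} {C : ℝ≥0}
    (hC0 : C ≠ 0) (hb : ∀ U ∈ 𝒰, ∀ f ∈ F, ∀ x ∈ U, f x ≤ b f U)
    (hC : ∀ U ∈ 𝒰, (F.map fun f => b f U).sum ≤ C) :
    (F.map (fractionalCover 𝒰)).sum ≤ C * fractionalCover 𝒰 1 := by
  conv_rhs => rw [fractionalCover]
  simp only [ENNReal.mul_iInf_of_ne (ENNReal.coe_ne_zero.2 hC0) ENNReal.coe_ne_top]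
  refine le_iInf₂ fun L hL => ?_
  -- A cover of `1` becomes a cover of `f` once the weight of each `U` is multiplied by `b f U`.
  have h1 : ∀ f ∈ F, fractionalCover 𝒰 f ≤ ((L.map fun q => b f q.2 * q.1).sum : ℝ≥0) := by
    intro f hf
    have : IsFractionalCover 𝒰 f (L.map fun q => (b f q.2 * q.1, q.2)) := by
      refine ⟨fun q hq => ?_, fun x => ?_⟩
      · obtain ⟨q, hq', rfl⟩ := List.mem_map.1 hq
        exact hL.1 q hq'
      · calc f x ≤ f x * coverSum L x := le_mul_of_one_le_right (zero_le) (hL.2 x)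
          _ = (L.map fun q => f x * (q.1 * q.2.indicator 1 x)).sum := by
            rw [coverSum, List.sum_map_mul_left]
          _ ≤ (L.map fun q => b f q.2 * q.1 * q.2.indicator 1 x).sum := by
            refine List.sum_le_sum fun q hq => ?_
            by_cases hx : x ∈ q.2
            · simpa [hx] using mul_le_mul_left (hb q.2 (hL.1 q hq) f hf x hx) q.1
            · simp [hx]
          _ = _ := by simp [coverSum, Function.comp_def]
    refine this.le_cost.trans (le_of_eq ?_)
    simp [coverCost, Function.comp_def]
  have h2 : ∀ L : List (ℝ≥0 × Set X), (∀ q ∈ L, q.2 ∈ 𝒰) →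
      (F.map fun f => (L.map fun q => b f q.2 * q.1).sum).sum ≤ C * coverCost L := by
    intro L hL
    induction L with
    | nil => simp
    | cons q L ih =>
      simp only [List.map_cons, List.sum_cons, List.sum_map_add, coverCost, mul_add,
        List.sum_map_mul_right]
      exact add_le_add (mul_le_mul_left (hC _ (hL q List.mem_cons_self)) _)
        (ih fun q' hq' => hL q' (List.mem_cons_of_mem _ hq'))
  calc (F.map (fractionalCover 𝒰)).sum
      ≤ (F.map fun f => (((L.map fun q => b f q.2 * q.1).sum : ℝ≥0) : ℝ≥0∞)).sum :=
        List.sum_le_sum h1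
    _ = (((F.map fun f => (L.map fun q => b f q.2 * q.1).sum).sum : ℝ≥0) : ℝ≥0∞) := by
        have := map_list_sum ENNReal.ofNNRealHom
          (F.map fun f => (L.map fun q => b f q.2 * q.1).sum)
        rw [List.map_map] at this
        exact this.symm
    _ ≤ _ := by exact_mod_cast h2 L hL.1

end FractionalCover

/-! ### From a sublinear functional to an invariant measure -/

section PartitionFunctional

variable {X : Type u} [TopologicalSpace X] (p : C(X, ℝ≥0) → ℝ≥0∞)

/-- The supremum of the sums of the values of `p` over the finite decompositions of `f`. -/
noncomputable def partitionSup (f : C(X, ℝ≥0)) : ℝ≥0∞ :=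
  ⨆ (F : List C(X, ℝ≥0)) (_ : F.sum = f), (F.map p).sum

variable {p}

theorem le_partitionSup {f : C(X, ℝ≥0)} {F : List C(X, ℝ≥0)} (h : F.sum = f) :
    (F.map p).sum ≤ partitionSup p f := le_iSup₂ (f := fun F (_ : F.sum = f) => (F.map p).sum) F h

theorem le_partitionSup_self (f : C(X, ℝ≥0)) : p f ≤ partitionSup p f := by
  simpa using le_partitionSup (p := p) (f := f) (F := [f]) (by simp)

/-- Riesz decomposition: cutting each piece in two turns a decomposition of `f + g` into one of `f`
and one of `g`, and by subadditivity cutting cannot lower the sum. -/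
theorem sum_map_le_partitionSup_add (hadd : ∀ f g, p (f + g) ≤ p f + p g)
    (F : List C(X, ℝ≥0)) : ∀ f g : C(X, ℝ≥0), F.sum = f + g →
      (F.map p).sum ≤ partitionSup p f + partitionSup p g := by
  suffices h : ∀ f g : C(X, ℝ≥0), F.sum = f + g → ∃ F₁ F₂ : List C(X, ℝ≥0), F₁.sum = f ∧
      F₂.sum = g ∧ (F.map p).sum ≤ (F₁.map p).sum + (F₂.map p).sum by
    intro f g hF
    obtain ⟨F₁, F₂, h₁, h₂, h⟩ := h f g hF
    exact h.trans (add_le_add (le_partitionSup h₁) (le_partitionSup h₂))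
  induction F with
  | nil =>
    intro f g hF
    have hx : ∀ x, f x = 0 ∧ g x = 0 := fun x => by
      have := congrArg (fun k : C(X, ℝ≥0) => k x) hF
      simpa using this.symm
    exact ⟨[], [], by ext x; simp [hx x], by ext x; simp [hx x], by simp⟩
  | cons h F ih =>
    intro f g hF
    have hx : ∀ x, h x + F.sum x = f x + g x := fun x =>
      congrArg (fun k : C(X, ℝ≥0) => k x) hF
    -- The piece `h` gives `h ⊓ f` to `f` and the rest to `g`; the rest is below `g` because `h ≤ f
    -- + g`.
    obtain ⟨F₁, F₂, h₁, h₂, hle⟩ := ih (f - h ⊓ f) (g - (h - h ⊓ f)) (by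
      ext x
      have := hx x
      simp only [ContinuousMap.add_apply, ContinuousMap.sub_apply, ContinuousMap.inf_apply]
      congr 1
      rcases le_total (h x) (f x) with hc | hc
      · rw [inf_eq_left.2 hc, tsub_self, tsub_zero, ← add_left_cancel_iff (a := h x), this,
          ← add_assoc, add_tsub_cancel_of_le hc]
      · have hg : h x - f x ≤ g x := tsub_le_iff_left.2 (this ▸ le_self_add)
        rw [inf_eq_right.2 hc, tsub_self, zero_add, ← add_left_cancel_iff (a := h x), this,
          ← add_tsub_cancel_of_le hg, add_tsub_cancel_left, ← add_assoc,
          add_tsub_cancel_of_le hc])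
    refine ⟨h ⊓ f :: F₁, (h - h ⊓ f) :: F₂, ?_, ?_, ?_⟩
    · ext x
      simp [h₁]
    · ext x
      have hg : h x - h x ⊓ f x ≤ g x := by
        rcases le_total (h x) (f x) with hc | hc
        · simp [hc]
        · rw [inf_eq_right.2 hc]
          exact tsub_le_iff_left.2 (hx x ▸ le_self_add)
      simp only [List.sum_cons, h₂, ContinuousMap.add_apply, ContinuousMap.sub_apply,
        ContinuousMap.inf_apply]
      rw [add_tsub_cancel_of_le hg]
    · have hh : h ⊓ f + (h - h ⊓ f) = h := by
        ext x
        simp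
      have := hadd (h ⊓ f) (h - h ⊓ f)
      rw [hh] at this
      simp only [List.map_cons, List.sum_cons]
      calc _ ≤ (p (h ⊓ f) + p (h - h ⊓ f)) + ((F₁.map p).sum + (F₂.map p).sum) :=
            add_le_add this hle
        _ = _ := add_add_add_comm _ _ _ _

theorem partitionSup_add (hadd : ∀ f g, p (f + g) ≤ p f + p g) (f g : C(X, ℝ≥0)) :
    partitionSup p (f + g) = partitionSup p f + partitionSup p g := by
  refine le_antisymm (iSup₂_le fun F hF => sum_map_le_partitionSup_add hadd F f g hF) ?_
  refine ENNReal.biSup_add_biSup_le' (p := fun F : List C(X, ℝ≥0) => F.sum = f)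
    (q := fun F : List C(X, ℝ≥0) => F.sum = g) ⟨[f], by simp⟩ ⟨[g], by simp⟩ fun F₁ h₁ F₂ h₂ => ?_
  simpa using le_partitionSup (p := p) (F := F₁ ++ F₂) (f := f + g) (by simp [h₁, h₂])

theorem partitionSup_smul (hsmul : ∀ (c : ℝ≥0) f, c ≠ 0 → p (c • f) ≤ c * p f) {c : ℝ≥0}
    (hc : c ≠ 0) (f : C(X, ℝ≥0)) : partitionSup p (c • f) = c * partitionSup p f := by
  have key : ∀ (c : ℝ≥0) (_ : c ≠ 0) f, partitionSup p (c • f) ≤ c * partitionSup p f := by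
    intro c hc f
    refine iSup₂_le fun F hF => ?_
    have h1 : (F.map fun f => c⁻¹ • f).sum = f := by
      rw [← List.smul_sum, hF, smul_smul, inv_mul_cancel₀ hc, one_smul]
    calc (F.map p).sum = (F.map fun f => p (c • c⁻¹ • f)).sum := by
          simp [smul_smul, mul_inv_cancel₀ hc]
      _ ≤ (F.map fun f => c * p (c⁻¹ • f)).sum := List.sum_le_sum fun f _ => hsmul c _ hc
      _ = c * ((F.map fun f => c⁻¹ • f).map p).sum := by
          rw [List.sum_map_mul_left, List.map_map]
          rfl
      _ ≤ _ := by gcongr; exact le_partitionSup h1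
  refine le_antisymm (key c hc f) ?_
  have := key c⁻¹ (inv_ne_zero hc) (c • f)
  rw [smul_smul, inv_mul_cancel₀ hc, one_smul] at this
  calc _ ≤ (c : ℝ≥0∞) * ((c⁻¹ : ℝ≥0) * partitionSup p (c • f)) := by gcongr
    _ = _ := by rw [← mul_assoc, ← ENNReal.coe_mul, mul_inv_cancel₀ hc, ENNReal.coe_one, one_mul]

theorem partitionSup_comp_le (φ : C(X, X)) (hφ : ∀ f, p f ≤ p (f.comp φ)) (f : C(X, ℝ≥0)) :
    partitionSup p f ≤ partitionSup p (f.comp φ) := by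
  refine iSup₂_le fun F hF => ?_
  calc (F.map p).sum ≤ (F.map fun f => p (f.comp φ)).sum := List.sum_le_sum fun f _ => hφ f
    _ = ((F.map fun f => f.comp φ).map p).sum := by rw [List.map_map]; rfl
    _ ≤ _ := le_partitionSup (by
      rw [← hF]
      exact (map_list_sum (ContinuousMap.compAddMonoidHom' φ) F).symm)

/-- An invariant sublinear function on the nonnegative continuous functions, with bounded sums over
the decompositions of each function, gives an invariant measure. -/
theorem exists_invariant_measure {G : Type v} [Group G] [MulAction G X] [ContinuousConstSMul G X]
    [CompactSpace X] [TopologicalSpace.MetrizableSpace X] [MeasurableSpace X] [BorelSpace X]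
    (hadd : ∀ f g, p (f + g) ≤ p f + p g)
    (hsmul : ∀ (c : ℝ≥0) f, c ≠ 0 → p (c • f) ≤ c * p f) (hone : p 1 ≠ 0)
    (hG : ∀ (g : G) (f : C(X, ℝ≥0)), p f ≤ p (f.comp ⟨fun x => g • x, continuous_const_smul g⟩))
    (hbdd : ∀ f : C(X, ℝ≥0), partitionSup p f ≠ ⊤) :
    ∃ μ : Measure X, IsFiniteMeasure μ ∧ μ ≠ 0 ∧ SMulInvariantMeasure G X μ := by
  have hzero : partitionSup p 0 = 0 := by
    have := partitionSup_add hadd 0 0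
    rw [add_zero] at this
    exact ((ENNReal.add_right_inj (hbdd 0)).1 ((add_zero _).trans this)).symm
  let Λ : C_c(X, ℝ≥0) →ₗ[ℝ≥0] ℝ≥0 :=
    { toFun := fun f => (partitionSup p f.toContinuousMap).toNNReal
      map_add' := fun f g => by
        rw [← ENNReal.toNNReal_add (hbdd _) (hbdd _), ← partitionSup_add hadd]
        rfl
      map_smul' := fun c f => by
        change (partitionSup p (c • f.toContinuousMap)).toNNReal = _
        rcases eq_or_ne c 0 with rfl | hc
        · simp [hzero]
        · simp [partitionSup_smul hsmul hc] }
  have hΛ : ∀ f : C(X, ℝ≥0), ∫⁻ x, f x ∂(NNRealRMK.rieszMeasure Λ) = partitionSup p f := by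
    intro f
    exact (NNRealRMK.lintegral_rieszMeasure Λ
      (CompactlySupportedContinuousMap.continuousMapEquiv f)).trans
      (ENNReal.coe_toNNReal (hbdd f))
  -- The one-sided inequality `hG`, used for `g` and for `g⁻¹`, gives equality.
  have hinv : ∀ (g : G) (f : C(X, ℝ≥0)),
      partitionSup p (f.comp ⟨fun x => g • x, continuous_const_smul g⟩) = partitionSup p f := by
    intro g f
    refine le_antisymm ?_ (partitionSup_comp_le _ (hG g) f)
    refine (partitionSup_comp_le _ (hG g⁻¹) _).trans (le_of_eq (congrArg _ ?_))
    ext x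
    simp
  have hfin : IsFiniteMeasure (NNRealRMK.rieszMeasure Λ) := inferInstance
  refine ⟨NNRealRMK.rieszMeasure Λ, hfin, fun h => hone ?_, ⟨fun g s hs => ?_⟩⟩
  · have := hΛ 1
    rw [h, lintegral_zero_measure] at this
    exact le_antisymm (this ▸ le_partitionSup_self 1) zero_le
  · have hg : Measurable fun x : X => g • x := (continuous_const_smul g).measurable
    rw [← Measure.map_apply hg hs]
    congr 1
    refine ext_of_forall_lintegral_eq_of_IsFiniteMeasure fun f => ?_
    rw [lintegral_map (by fun_prop) hg]
    exact (hΛ (f.toContinuousMap.comp ⟨fun x => g • x, continuous_const_smul g⟩)).trans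
      ((hinv g _).trans (hΛ f.toContinuousMap).symm)

end PartitionFunctional

/-! ### Covering by non-separating sets -/

section NonSeparating

/-- The sets in which no element of `G` makes `m` points pairwise at least `ε` apart. -/
def nonSeparating (G : Type v) (X : Type u) [MetricSpace X] [SMul G X] (m : ℕ) (ε : ℝ) :
    Set (Set X) :=
  {U | ∀ x : Fin m → X, (∀ i, x i ∈ U) → ∀ g : G, ∃ i j, i ≠ j ∧ dist (g • x i) (g • x j) < ε}

variable {G : Type v} {X : Type u} [Group G] [MetricSpace X] [MulAction G X] {m : ℕ} {ε : ℝ}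

theorem preimage_smul_mem_nonSeparating (g : G) {U : Set X} (hU : U ∈ nonSeparating G X m ε) :
    (fun x => g • x) ⁻¹' U ∈ nonSeparating G X m ε := by
  intro x hx h
  obtain ⟨i, j, hij, hd⟩ := hU (fun i => g • x i) hx (h * g⁻¹)
  exact ⟨i, j, hij, by simpa [mul_smul] using hd⟩

/-- Choose `ε`-separated points of `U` greedily: `m` of them would contradict the hypothesis at `g =
1`, so the choice stops. -/
theorem exists_finset_dist_lt {U : Set X} (hU : U ∈ nonSeparating G X m ε) :
    ∃ s : Finset X, s.card ≤ m ∧ ∀ u ∈ U, ∃ z ∈ s, dist u z < ε := by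
  classical
  by_contra! hcon
  have key : ∀ k ≤ m, ∃ x : Fin k → X, (∀ i, x i ∈ U) ∧ ∀ i j, i ≠ j → ε ≤ dist (x i) (x j) := by
    intro k
    induction k with
    | zero => exact fun _ => ⟨Fin.elim0, fun i => i.elim0, fun i => i.elim0⟩
    | succ k ih =>
      intro hk
      obtain ⟨x, hxU, hx⟩ := ih (by omega)
      obtain ⟨u, huU, hu⟩ := hcon (Finset.univ.image x)
        (Finset.card_image_le.trans (by simp; omega))
      have hu' : ∀ i, ε ≤ dist u (x i) := fun i => hu _ (by simp)
      refine ⟨Fin.cons u x, fun i => ?_, fun i j => ?_⟩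
      · refine Fin.cases ?_ (fun i => ?_) i <;> simp [huU, hxU]
      · refine Fin.cases ?_ (fun i => ?_) i <;> refine Fin.cases ?_ (fun j => ?_) j
        · simp
        · simpa using fun _ => hu' j
        · simpa [dist_comm] using hu' i
        · simpa using hx i j
  obtain ⟨x, hxU, hx⟩ := key m le_rfl
  obtain ⟨i, j, hij, hd⟩ := hU x hxU 1
  rw [one_smul, one_smul] at hd
  exact absurd hd (not_lt.2 (hx i j hij))

theorem sum_map_sum_add {Y : Type*} [TopologicalSpace Y] (F : List C(Y, ℝ≥0)) (s : Finset Y)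
    (η : ℝ≥0) : (F.map fun f => ∑ z ∈ s, (f z + η)).sum = ∑ z ∈ s, (F.sum z + F.length * η) := by
  induction F with
  | nil => simp
  | cons f F ih =>
    rw [List.map_cons, List.sum_cons, ih, ← Finset.sum_add_distrib]
    refine Finset.sum_congr rfl fun z _ => ?_
    simp only [List.sum_cons, ContinuousMap.add_apply, List.length_cons, Nat.cast_add, Nat.cast_one]
    ring

theorem exists_forall_mem_le_add [CompactSpace X] (F : List C(X, ℝ≥0)) {η : ℝ≥0} (hη : 0 < η) :
    ∃ δ > 0, ∀ f ∈ F, ∀ x y, dist x y < δ → f x ≤ f y + η := by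
  induction F with
  | nil => exact ⟨1, one_pos, by simp⟩
  | cons f F ih =>
    obtain ⟨δ, hδ, h⟩ := ih
    obtain ⟨δ', hδ', h'⟩ := Metric.uniformContinuous_iff.1
      (CompactSpace.uniformContinuous_of_continuous f.continuous) η hη
    refine ⟨min δ δ', lt_min hδ hδ', fun k hk x y hxy => ?_⟩
    rcases List.mem_cons.1 hk with rfl | hk
    · have := h' (hxy.trans_le (min_le_right _ _))
      rw [NNReal.dist_eq] at this
      have := (abs_lt.1 this).2
      rw [← NNReal.coe_le_coe, NNReal.coe_add]
      linarith
    · exact h k hk x y (hxy.trans_le (min_le_left _ _))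

variable (G m)

theorem exists_sum_fractionalCover_le [CompactSpace X] (F : List C(X, ℝ≥0)) {c : ℝ≥0}
    (hc : ∀ x, F.sum x ≤ c) : ∃ δ > 0, ∀ ε ≤ δ,
      (F.map fun f : C(X, ℝ≥0) => fractionalCover (nonSeparating G X m ε) f).sum ≤
        (m * (c + 1) + 1 : ℝ≥0) * fractionalCover (nonSeparating G X m ε) 1 := by
  classical
  -- The oscillation allowed to each function is such that the total error at a point is at most
  -- `1`.
  set η : ℝ≥0 := (F.length + 1 : ℝ≥0)⁻¹ with hη
  have hη1 : F.length * η ≤ 1 := by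
    rw [hη, ← div_eq_mul_inv]
    exact div_le_one_of_le₀ (by simp) zero_le
  obtain ⟨δ, hδ, h⟩ := exists_forall_mem_le_add F (η := η) (by positivity)
  refine ⟨δ, hδ, fun ε hε => ?_⟩
  have hs : ∀ U : Set X, ∃ s : Finset X, U ∈ nonSeparating G X m ε →
      s.card ≤ m ∧ ∀ u ∈ U, ∃ z ∈ s, dist u z < ε := fun U => by
    by_cases hU : U ∈ nonSeparating G X m ε
    · obtain ⟨s, hs⟩ := exists_finset_dist_lt hU
      exact ⟨s, fun _ => hs⟩
    · exact ⟨∅, fun h => absurd h hU⟩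
  choose s hs using hs
  -- Each of the at most `m` centers contributes at most `c + 1`; the final `+ 1` keeps the constant
  -- nonzero when `m = 0`.
  have := sum_fractionalCover_le (𝒰 := nonSeparating G X m ε) (F := F.map fun f : C(X, ℝ≥0) => (f : X → ℝ≥0))
    (b := fun f U => ∑ z ∈ s U, (f z + η)) (C := m * (c + 1) + 1) (by positivity) ?_ ?_
  · simpa [List.map_map, Function.comp_def] using this
  · intro U hU f hf x hx
    obtain ⟨f, hf', rfl⟩ := List.mem_map.1 hf
    obtain ⟨z, hz, hxz⟩ := (hs U hU).2 x hx
    exact (h f hf' x z (hxz.trans_le hε)).trans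
      (Finset.single_le_sum (f := fun z => f z + η) (fun _ _ => zero_le) hz)
  · intro U hU
    rw [List.map_map]
    refine (sum_map_sum_add F (s U) η).trans_le ?_
    calc ∑ z ∈ s U, (F.sum z + F.length * η) ≤ ∑ z ∈ s U, (c + 1) :=
          Finset.sum_le_sum fun z _ => add_le_add (hc z) hη1
      _ = (s U).card * (c + 1) := by simp [mul_add]
      _ ≤ m * (c + 1) := by gcongr; exact (hs U hU).1
      _ ≤ _ := le_self_add

end NonSeparating

/-! ### The limit of normalized covering numbers -/

section LimitCover

variable {X : Type u} [TopologicalSpace X] (𝒰 : ℕ → Set (Set X))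

/-- The limit, along a fixed ultrafilter, of the fractional covering numbers of `f`, normalized by
those of the constant function `1`. -/
noncomputable def limitCover (f : C(X, ℝ≥0)) : ℝ≥0∞ :=
  ((hyperfilter ℕ).map fun n => fractionalCover (𝒰 n) f / fractionalCover (𝒰 n) 1).lim

/-- `ℝ≥0∞` is compact, so every ultrafilter on it converges. -/
theorem tendsto_limitCover (f : C(X, ℝ≥0)) :
    Tendsto (fun n => fractionalCover (𝒰 n) f / fractionalCover (𝒰 n) 1) (hyperfilter ℕ)
      (𝓝 (limitCover 𝒰 f)) := Ultrafilter.le_nhds_lim _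

theorem limitCover_add_le (f g : C(X, ℝ≥0)) :
    limitCover 𝒰 (f + g) ≤ limitCover 𝒰 f + limitCover 𝒰 g :=
  le_of_tendsto_of_tendsto' (tendsto_limitCover 𝒰 (f + g))
    ((tendsto_limitCover 𝒰 f).add (tendsto_limitCover 𝒰 g)) fun n => by
      rw [← ENNReal.add_div]
      exact ENNReal.div_le_div_right fractionalCover_add_le _

theorem limitCover_smul_le (c : ℝ≥0) (f : C(X, ℝ≥0)) (hc : c ≠ 0) :
    limitCover 𝒰 (c • f) ≤ c * limitCover 𝒰 f :=
  le_of_tendsto_of_tendsto' (tendsto_limitCover 𝒰 (c • f))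
    (ENNReal.Tendsto.const_mul (tendsto_limitCover 𝒰 f) (Or.inr ENNReal.coe_ne_top)) fun n => by
      rw [← mul_div_assoc]
      exact ENNReal.div_le_div_right (fractionalCover_smul_le hc) _

theorem limitCover_one [Nonempty X] (h : ∀ n, fractionalCover (𝒰 n) 1 ≠ ⊤) :
    limitCover 𝒰 1 = 1 := by
  refine tendsto_nhds_unique (tendsto_limitCover 𝒰 1) (tendsto_const_nhds.congr fun n => ?_)
  obtain ⟨x⟩ := ‹Nonempty X›
  have h1 : (1 : ℝ≥0∞) ≤ fractionalCover (𝒰 n) (1 : X → ℝ≥0) := by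
    simpa using le_fractionalCover (𝒰 := 𝒰 n) (f := 1) x
  exact (ENNReal.div_self (one_pos.trans_le h1).ne' (h n)).symm

theorem limitCover_le_comp_smul {G : Type v} [Group G] [MulAction G X] [ContinuousConstSMul G X]
    (h𝒰 : ∀ n, ∀ (g : G), ∀ U ∈ 𝒰 n, (fun x => g • x) ⁻¹' U ∈ 𝒰 n) (g : G) (f : C(X, ℝ≥0)) :
    limitCover 𝒰 f ≤ limitCover 𝒰 (f.comp ⟨fun x => g • x, continuous_const_smul g⟩) :=
  le_of_tendsto_of_tendsto' (tendsto_limitCover 𝒰 _) (tendsto_limitCover 𝒰 _) fun n => by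
    refine ENNReal.div_le_div_right ?_ _
    simpa [Function.comp_def] using fractionalCover_comp_smul_le (f := fun x => f (g • x)) g⁻¹ (h𝒰 n)

end LimitCover

/-! ### An invariant measure in the absence of sensitivity -/

section InvariantMeasure

variable {G : Type v} {X : Type u} [Group G] [MetricSpace X] [CompactSpace X] [MulAction G X]

/-- Only the scale `δ` depends on the decomposition, not the bound; in the limit the scale
disappears. -/
theorem partitionSup_limitCover_ne_top (m : ℕ)
    (f : C(X, ℝ≥0)) :
    partitionSup (limitCover fun n : ℕ => nonSeparating G X m (1 / (n + 1))) f ≠ ⊤ := by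
  obtain ⟨c, hc⟩ := (isCompact_range f.continuous).bddAbove
  have hc' : ∀ x, f x ≤ c := fun x => hc ⟨x, rfl⟩
  refine ne_top_of_le_ne_top (ENNReal.coe_ne_top (r := m * (c + 1) + 1)) (iSup₂_le fun F hF => ?_)
  obtain ⟨δ, hδ, hle⟩ := exists_sum_fractionalCover_le G m F (c := c) (hF ▸ hc')
  refine le_of_tendsto (tendsto_list_sum F fun f _ =>
    tendsto_limitCover (fun n : ℕ => nonSeparating G X m (1 / (n + 1))) f) ?_
  have hev : ∀ᶠ n : ℕ in atTop, (1 / (n + 1) : ℝ) ≤ δ :=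
    tendsto_one_div_add_atTop_nhds_zero_nat.eventually_le_const hδ
  filter_upwards [Nat.hyperfilter_le_atTop hev] with n hn
  simp only [div_eq_mul_inv, List.sum_map_mul_right]
  rw [← div_eq_mul_inv]
  refine ENNReal.div_le_of_le_mul ?_
  simpa using hle _ hn

variable [Nonempty X] [ContinuousConstSMul G X] [MulAction.IsMinimal G X]

/-- A minimal action that is not `m`-sensitive has an invariant measure. -/
theorem exists_invariant_measure_of_not_isMultiSensitive [MeasurableSpace X] [BorelSpace X] {m : ℕ}
    (hm : ¬ IsMultiSensitive G X m) :
    ∃ μ : Measure X, IsFiniteMeasure μ ∧ μ ≠ 0 ∧ SMulInvariantMeasure G X μ := by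
  have hfin : ∀ n : ℕ, fractionalCover (nonSeparating G X m (1 / (n + 1))) 1 ≠ ⊤ := by
    intro n
    unfold IsMultiSensitive at hm
    push Not at hm
    obtain ⟨U, hUo, hUne, hU⟩ := hm (1 / (n + 1)) (by positivity)
    have hUmem : U ∈ nonSeparating G X m (1 / (n + 1)) := by
      intro x hx g
      -- The negated sensitivity speaks of injective tuples only; any other tuple has two entries at
      -- distance `0`.
      by_cases hinj : Function.Injective x
      · exact hU x hinj hx g
      · simp only [Function.Injective] at hinj
        push Not at hinj
        obtain ⟨i, j, hij, hne⟩ := hinj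
        exact ⟨i, j, hne, by rw [hij, dist_self]; positivity⟩
    obtain ⟨I, hI⟩ := isCompact_univ.exists_finite_cover_smul G hUo hUne
    have hcov : IsFractionalCover (nonSeparating G X m (1 / (n + 1))) 1
        (I.toList.map fun g : G => ((1 : ℝ≥0), g • U)) := by
      refine ⟨fun q hq => ?_, fun x => ?_⟩
      · obtain ⟨g, -, rfl⟩ := List.mem_map.1 hq
        have := preimage_smul_mem_nonSeparating g⁻¹ hUmem
        rwa [preimage_smul_inv] at this
      · obtain ⟨g, hg, hx⟩ := mem_iUnion₂.1 (hI (mem_univ x))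
        refine le_trans ?_ (List.single_le_sum (fun _ _ => zero_le) _
          (List.mem_map.2 ⟨_, List.mem_map.2 ⟨g, Finset.mem_toList.2 hg, rfl⟩, rfl⟩))
        simp [hx]
    exact ne_top_of_le_ne_top ENNReal.coe_ne_top hcov.le_cost
  exact exists_invariant_measure (limitCover_add_le _) (limitCover_smul_le _)
    (by rw [limitCover_one _ hfin]; exact one_ne_zero)
    (limitCover_le_comp_smul (G := G) _ fun n g U hU => preimage_smul_mem_nonSeparating g hU)
    (partitionSup_limitCover_ne_top m)

end InvariantMeasure

/-! ### Exchanging coordinates within fibers -/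

section ProductSlices

variable {G : Type v} {X : Type u} [Group G] [TopologicalSpace G] [MetricSpace X]
  [CompactSpace X] [MulAction G X] [ContinuousSMul G X] [MulAction.IsMinimal G X]
  {ι : Type w} [Fintype ι] [DecidableEq ι] {N : Set (ι → X)}

/-- In a closed invariant set of tuples a coordinate can be replaced, throughout an open set of
tuples, by any point with the same image in the maximal equicontinuous factor. -/
theorem update_mem_of_proj_eq [MeasurableSpace X] [BorelSpace X] (μ : Measure X)
    [IsFiniteMeasure μ] [μ.IsOpenPosMeasure] [SMulInvariantMeasure G X μ] (hN : IsClosed N)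
    (hGN : ∀ (g : G), ∀ x ∈ N, g • x ∈ N) (i : ι) {a b : X}
    (hab : MaxEqFactor.proj G X a = MaxEqFactor.proj G X b) {O : Set (ι → X)} (hO : IsOpen O)
    (h : ∀ w ∈ O, Function.update w i a ∈ N) : ∀ w ∈ O, Function.update w i b ∈ N := by
  set R : Set (X × (ι → X)) := {q | Function.update q.2 i q.1 ∈ N} with hRdef
  have hR : IsClosed R := hN.preimage (continuous_snd.update i continuous_fst)
  have hGR : ∀ (g : G) x z, (x, z) ∈ R → (g • x, g • z) ∈ R := by
    intro g x z hxz
    have := hGN g _ hxz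
    rwa [← Function.update_smul] at this
  have hinv : SMulInvariantMeasure G (ι → X) (Measure.pi fun _ => μ) := by
    refine ⟨fun g s hs => ?_⟩
    have := measurePreserving_pi (fun _ : ι => μ) (fun _ : ι => μ)
      (fun _ => measurePreserving_smul g μ)
    exact this.measure_preimage hs.nullMeasurableSet
  have hnull := measure_slice_diff_eq_zero (Measure.pi fun _ : ι => μ) hR hGR hab
  -- The exceptional tuples form an open null set, which is empty because the product measure has
  -- full support.
  have hOb : IsOpen (O \ Prod.mk b ⁻¹' R) := hO.sdiff (hR.preimage (by fun_prop))
  have hempty := (hOb.measure_eq_zero_iff (Measure.pi fun _ : ι => μ)).1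
    (measure_mono_null (t := Prod.mk a ⁻¹' R \ Prod.mk b ⁻¹' R)
      (sdiff_subset_sdiff_left fun w hw => h w hw) hnull)
  exact fun w hw => by_contra fun hb => (hempty ▸ (⟨hw, hb⟩ : w ∈ O \ Prod.mk b ⁻¹' R) :
    w ∈ (∅ : Set (ι → X)))

theorem mem_of_forall_mem_preimage [MeasurableSpace X] [BorelSpace X] (μ : Measure X)
    [IsFiniteMeasure μ] [μ.IsOpenPosMeasure] [SMulInvariantMeasure G X μ] (hN : IsClosed N)
    (hGN : ∀ (g : G), ∀ x ∈ N, g • x ∈ N) {U : Set X} (hU : IsOpen U)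
    (hUN : ∀ x : ι → X, (∀ i, x i ∈ U) → x ∈ N) {W : Set (MaxEqFactor G X)} (hW : IsOpen W)
    (hWU : W ⊆ MaxEqFactor.proj G X '' U) :
    ∀ x : ι → X, (∀ i, MaxEqFactor.proj G X (x i) ∈ W) → x ∈ N := by
  set V := MaxEqFactor.proj G X ⁻¹' W with hV
  have hVo : IsOpen V := hW.preimage (MaxEqFactor.continuous_proj G X)
  -- Coordinates are released from `U` to `V` one at a time; `s` is the set of those already
  -- released.
  have key : ∀ s : Finset ι, ∀ x : ι → X, (∀ i, x i ∈ if i ∈ s then V else U) → x ∈ N := by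
    intro s
    induction s using Finset.induction_on with
    | empty => exact fun x hx => hUN x (by simpa using hx)
    | insert i s hi ih =>
      intro x hx
      have hxi : x i ∈ V := by simpa using hx i
      obtain ⟨a, haU, ha⟩ := hWU hxi
      -- Coordinate `i` is unrestricted since it gets overwritten.
      have hO : IsOpen (univ.pi fun j => if j = i then univ else if j ∈ s then V else U) :=
        isOpen_set_pi finite_univ fun j _ => by split_ifs <;> simp [hVo, hU]
      have := update_mem_of_proj_eq μ hN hGN i ha hO (fun w hw => ih _ fun j => ?_) x ?_
      · simpa using this
      · by_cases hj : j = i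
        · subst hj
          simpa [hi] using haU
        · simpa [hj] using hw j (mem_univ j)
      · intro j _
        by_cases hj : j = i
        · simp [hj]
        · simpa [hj] using hx j
  intro x hx
  exact key Finset.univ x (by simpa [hV] using hx)

/-- The projection to the maximal equicontinuous factor is semi-open. -/
theorem exists_isOpen_subset_image_proj [Nonempty X] {U : Set X} (hU : IsOpen U)
    (hne : U.Nonempty) :
    ∃ W : Set (MaxEqFactor G X), IsOpen W ∧ W.Nonempty ∧ W ⊆ MaxEqFactor.proj G X '' U := by
  obtain ⟨u, hu⟩ := hne
  obtain ⟨K, hK, hKc, hKU⟩ := exists_mem_nhds_isClosed_subset (hU.mem_nhds hu)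
  -- Finitely many translates of the closed image of `K` cover `X_eq`, so by Baire one of them,
  -- hence the image itself, has interior.
  obtain ⟨I, hI⟩ := isCompact_univ.exists_finite_cover_smul G isOpen_interior
    ⟨u, mem_interior_iff_mem_nhds.2 hK⟩
  have hF : IsClosed (MaxEqFactor.proj G X '' K) :=
    (MaxEqFactor.continuous_proj G X).isClosedMap _ hKc
  have : Nonempty (MaxEqFactor G X) := ‹Nonempty X›.map (MaxEqFactor.proj G X)
  obtain ⟨g, hg⟩ := nonempty_interior_of_iUnion_of_closed
    (f := fun g : I => (g : G) • (MaxEqFactor.proj G X '' K)) (fun g => hF.smul _) (by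
      refine eq_univ_of_forall fun z => ?_
      obtain ⟨x, rfl⟩ := MaxEqFactor.proj_surjective G X z
      obtain ⟨g, hg, y, hy, rfl⟩ := mem_iUnion₂.1 (hI (mem_univ x))
      exact mem_iUnion.2 ⟨⟨g, hg⟩, _, ⟨y, interior_subset hy, rfl⟩, rfl⟩)
  rw [interior_smul] at hg
  exact ⟨_, isOpen_interior, smul_set_nonempty.1 hg,
    interior_subset.trans (image_mono hKU)⟩

/-- If there is an invariant measure, points of one fiber can be approximated simultaneously by a
translate of any given non-empty open set. -/
theorem exists_smul_dist_lt [Nonempty X] [MeasurableSpace X] [BorelSpace X] (μ : Measure X)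
    [IsFiniteMeasure μ] [μ.IsOpenPosMeasure] [SMulInvariantMeasure G X μ] {x : ι → X}
    (hx : ∀ i j, MaxEqFactor.proj G X (x i) = MaxEqFactor.proj G X (x j)) {U : Set X}
    (hU : IsOpen U) (hne : U.Nonempty) {ρ : ℝ} (hρ : 0 < ρ) :
    ∃ (g : G) (u : ι → X), (∀ i, u i ∈ U) ∧ ∀ i, dist (g • u i) (x i) < ρ := by
  set N : Set (ι → X) := closure {w | ∃ (g : G) (u : ι → X), (∀ i, u i ∈ U) ∧ w = g • u} with hN
  have hGN : ∀ (g : G), ∀ w ∈ N, g • w ∈ N := by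
    intro g w hw
    refine map_mem_closure (continuous_const_smul g) hw ?_
    rintro _ ⟨h, u, hu, rfl⟩
    exact ⟨g * h, u, hu, (mul_smul g h u).symm⟩
  obtain ⟨W, hW, hWne, hWU⟩ := exists_isOpen_subset_image_proj (G := G) hU hne
  have hmem := mem_of_forall_mem_preimage (G := G) (N := N) μ isClosed_closure hGN hU
    (fun u hu => subset_closure ⟨1, u, hu, (one_smul G u).symm⟩) hW hWU
  have hxN : x ∈ N := by
    rcases isEmpty_or_nonempty ι with hι | ⟨⟨i₀⟩⟩
    · exact hmem x fun i => hι.elim i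
    -- By minimality some `g` carries the common fiber of the `x i` over `W`; invariance of `N`
    -- brings the tuple back.
    obtain ⟨g, hg⟩ := (hW.preimage (MaxEqFactor.continuous_proj G X)).exists_smul_mem G (x i₀)
      (hWne.preimage (MaxEqFactor.proj_surjective G X))
    have := hGN g⁻¹ _ (hmem (g • x) fun i => by
      have h : MaxEqFactor.proj G X (g • x i₀) ∈ W := hg
      rw [MaxEqFactor.proj_smul, hx i₀ i] at h
      exact h)
    rwa [inv_smul_smul] at this
  obtain ⟨_, ⟨g, u, hu, rfl⟩, hd⟩ := Metric.mem_closure_iff.1 hxN ρ hρ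
  refine ⟨g, u, hu, fun i => ?_⟩
  rw [dist_comm]
  exact (dist_le_pi_dist x (g • u) i).trans_lt hd

end ProductSlices

/-! ### Rank and tuples in a fiber -/

section Rank

variable {G : Type v} {X : Type u} [Group G] [TopologicalSpace G] [MetricSpace X]
  [MulAction G X]

theorem le_maximalRank_iff {m : ℕ} [Nonempty X] : (m : ℕ∞) ≤ maximalRank G X ↔
    ∃ x : Fin m → X, Function.Injective x ∧
      ∀ i j, MaxEqFactor.proj G X (x i) = MaxEqFactor.proj G X (x j) := by
  constructor
  · intro h
    have hz : ∃ z : MaxEqFactor G X, (m : ℕ∞) ≤ (MaxEqFactor.proj G X ⁻¹' {z}).encard := by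
      rcases m with _ | m
      · exact ⟨MaxEqFactor.proj G X (Classical.arbitrary X), by simp⟩
      · have hlt : (m : ℕ∞) < maximalRank G X :=
          lt_of_lt_of_le (by exact_mod_cast Nat.lt_succ_self m) h
        obtain ⟨z, hz⟩ := lt_iSup_iff.1 hlt
        exact ⟨z, by simpa using Order.add_one_le_of_lt hz⟩
    obtain ⟨z, hz⟩ := hz
    obtain ⟨t, ht, htm⟩ := exists_subset_encard_eq hz
    have hfin : t.Finite := finite_of_encard_eq_coe htm
    have hcard : hfin.toFinset.card = m := by
      rw [hfin.encard_eq_coe_toFinset_card] at htm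
      exact_mod_cast htm
    let e := hfin.toFinset.equivFinOfCardEq hcard
    have he : ∀ i, MaxEqFactor.proj G X (e.symm i) = z := fun i =>
      ht (hfin.mem_toFinset.1 (e.symm i).2)
    exact ⟨fun i => e.symm i, Subtype.val_injective.comp e.symm.injective,
      fun i j => (he i).trans (he j).symm⟩
  · rintro ⟨x, hinj, hx⟩
    rcases isEmpty_or_nonempty (Fin m) with hm | ⟨⟨i₀⟩⟩
    · have : m = 0 := by
        rw [← Fintype.card_fin m]
        exact Fintype.card_eq_zero_iff.2 hm
      simp [this]
    · calc (m : ℕ∞) = (range x).encard := by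
            rw [← image_univ, hinj.encard_image, encard_univ]
            simp
        _ ≤ (MaxEqFactor.proj G X ⁻¹' {MaxEqFactor.proj G X (x i₀)}).encard :=
            encard_le_encard (range_subset_iff.2 fun i => hx i i₀)
        _ ≤ _ := le_iSup (fun z => (MaxEqFactor.proj G X ⁻¹' {z}).encard) _

theorem exists_injective_of_isMultiSensitive [CompactSpace X] [Nonempty X] {m : ℕ}
    (h : IsMultiSensitive G X m) : ∃ x : Fin m → X, Function.Injective x ∧
      ∀ i j, MaxEqFactor.proj G X (x i) = MaxEqFactor.proj G X (x j) := by
  obtain ⟨ε, hε, h⟩ := h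
  obtain ⟨x₀⟩ := ‹Nonempty X›
  choose x hinj hx g hg using fun n : ℕ => h (Metric.ball x₀ (1 / (n + 1))) Metric.isOpen_ball
    ⟨x₀, Metric.mem_ball_self (by positivity)⟩
  obtain ⟨z, φ, hφ, hz⟩ := CompactSpace.tendsto_subseq fun n => g n • x n
  have hzi : ∀ i, Tendsto (fun n => g (φ n) • x (φ n) i) atTop (𝓝 (z i)) :=
    tendsto_pi_nhds.1 hz
  refine ⟨z, fun i j hij => ?_, fun i j => ?_⟩
  · by_contra hne
    have := ge_of_tendsto' ((hzi i).dist (hzi j)) fun n => hg (φ n) i j hne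
    rw [hij, dist_self] at this
    exact absurd hε (not_lt.2 this)
  · have hx₀ : ∀ i, Tendsto (fun n => x n i) atTop (𝓝 x₀) := fun i =>
      tendsto_iff_dist_tendsto_zero.2 (squeeze_zero (fun _ => dist_nonneg)
        (fun n => (hx n i).le) tendsto_one_div_add_atTop_nhds_zero_nat)
    have hp := MaxEqFactor.continuous_proj G X
    refine eq_of_forall_dist_le fun η hη => ?_
    -- Before translation the projected points both tend to the image of `x₀`; equicontinuity keeps
    -- them close under `g (φ n)`, however wild these elements are.
    obtain ⟨δ, hδ, hδη⟩ := MaxEqFactor.isEquicontinuousAction G X η hη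
    have hdist : Tendsto (fun n => dist (MaxEqFactor.proj G X (x (φ n) i))
        (MaxEqFactor.proj G X (x (φ n) j))) atTop (𝓝 0) := by
      have := ((hp.tendsto x₀).comp ((hx₀ i).comp hφ.tendsto_atTop)).dist
        ((hp.tendsto x₀).comp ((hx₀ j).comp hφ.tendsto_atTop))
      simpa [Function.comp_def] using this
    refine le_of_tendsto (((hp.tendsto _).comp (hzi i)).dist ((hp.tendsto _).comp (hzi j))) ?_
    filter_upwards [hdist.eventually_lt_const hδ] with n hn
    exact (hδη _ _ hn (g (φ n))).le

end Rank

/-! ### Sensitivity from a large fiber -/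

theorem isMultiSensitive_of_injective {G : Type v} {X : Type u} [Group G] [TopologicalSpace G]
    [MetricSpace X] [CompactSpace X] [Nonempty X] [MulAction G X] [ContinuousSMul G X]
    [MulAction.IsMinimal G X] {m : ℕ} {x : Fin m → X} (hinj : Function.Injective x)
    (hx : ∀ i j, MaxEqFactor.proj G X (x i) = MaxEqFactor.proj G X (x j)) :
    IsMultiSensitive G X m := by
  -- The negation serves to produce the invariant measure; sensitivity is then proved outright.
  by_contra hcon
  let : MeasurableSpace X := borel X
  have : BorelSpace X := ⟨rfl⟩
  obtain ⟨μ, _, hμ, _⟩ := exists_invariant_measure_of_not_isMultiSensitive hcon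
  have : μ.IsOpenPosMeasure :=
    ⟨fun U hU hne => (measure_isOpen_pos_of_smulInvariant_of_ne_zero G hμ hU hne).ne'⟩
  obtain ⟨D, hD, hDx⟩ : ∃ D > 0, ∀ i j, i ≠ j → D ≤ dist (x i) (x j) := by
    have hev : ∀ᶠ D in 𝓝[>] (0 : ℝ), ∀ i j, i ≠ j → D ≤ dist (x i) (x j) := by
      refine eventually_all.2 fun i => eventually_all.2 fun j => ?_
      by_cases hij : i = j
      · simp [hij]
      · filter_upwards [mem_nhdsWithin_of_mem_nhds (Iic_mem_nhds (dist_pos.2 (hinj.ne hij)))]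
          with D hD _ using hD
    obtain ⟨D, hDx, hD⟩ := (hev.and self_mem_nhdsWithin).exists
    exact ⟨D, hD, hDx⟩
  -- Approximating two points to within `D / 3` each leaves `D / 3` of their distance `D`.
  refine hcon ⟨D / 3, by positivity, fun U hU hne => ?_⟩
  obtain ⟨g, u, huU, hu⟩ := exists_smul_dist_lt (G := G) μ hx hU hne (ρ := D / 3) (by positivity)
  have hsep : ∀ i j, i ≠ j → D / 3 ≤ dist (g • u i) (g • u j) := by
    intro i j hij
    have h1 := dist_triangle4 (x i) (g • u i) (g • u j) (x j)
    have h2 := hu i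
    rw [dist_comm] at h2
    linarith [hDx i j hij, hu j]
  refine ⟨u, fun i j hij => ?_, huU, g, hsep⟩
  by_contra hne
  have := hsep i j hne
  rw [hij, dist_self] at this
  linarith

theorem mainTheorem8 {G : Type v} {X : Type u} [Group G] [TopologicalSpace G]
    [IsTopologicalGroup G] [LocallyCompactSpace G] [MetricSpace X] [CompactSpace X] [Nonempty X]
    [MulAction G X] [ContinuousSMul G X] [MulAction.IsMinimal G X] (m : ℕ) (hm : 2 ≤ m) :
    IsMultiSensitive G X m ↔ (m : ℕ∞) ≤ maximalRank G X := by
  rw [le_maximalRank_iff]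
  exact ⟨exists_injective_of_isMultiSensitive,
    fun ⟨_, hinj, hx⟩ => isMultiSensitive_of_injective hinj hx⟩
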